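/- For $f:\{0,1\}^n\to\mathbb R$ write $\|f\|_2=(\mathbb E_x[f(x)^2])^{1/2}$ and $\hat f(S)=\mathbb E_x[f(x)(-1)^{\sum_{i\in S}x_i}]$ for $S\subseteq[n]$, where $x$ is uniform on $\{0,1\}^n$; the Fourier degree of $f$ is the largest $|S|$ with $\hat f(S)\ne0$ (and $0$ if $f=0$), and $f$ is a $k$-junta if it depends on at most $k$ of its variables. The function $f$ is XOS if $f(x)=\max_{w\in C}\sum_{i=1}^n w_ix_i$ for all $x$, for some nonempty finite set $C$ of vectors $w\in\mathbb R_{\ge0}^n$. (1) There is an absolute constant $K>0$ such that for every $n$, every XOS function $f:\{0,1\}^n\to[0,1]$ and every $\varepsilon>0$ there is a function $p:\{0,1\}^n\to\mathbb R$ that is a $k$-junta for some $k\le 2^{K/\varepsilon}$, has Fourier degree at most $K/\varepsilon$, and satisfies $\|f-p\|_2\le\varepsilon$ and $\sum_{S\subseteq[n]}|\hat p(S)|\le 2^{K/\varepsilon^2}$. (2) The junta size in (1) is optimal up to the constant in the exponent: there are absolute constants $c,\varepsilon_0>0$ such that for every $\varepsilon\in(0,\varepsilon_0]$ there are an $n$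 and an XOS function $f:\{0,1\}^n\to[0,1]$ such that every $k$-junta $g:\{0,1\}^n\to\mathbb R$ with $\|f-g\|_2\le\varepsilon$ has $k\ge 2^{c/\varepsilon}$. -/

import Mathlib

open scoped BigOperators

noncomputable section

namespace BoolCube

/-- The real number `0` or `1` corresponding to a bit. -/
def bit (b : Bool) : ℝ := if b then 1 else 0

/-- The function `f` on `{0,1}^n` is XOS: it is the maximum of a nonempty finite family of
linear functions `x ↦ ∑ i, w i * x i` with nonnegative weights. -/
def IsXOS {n : ℕ} (f : (Fin n → Bool) → ℝ) : Prop :=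
  ∃ (C : Finset (Fin n → ℝ)) (hC : C.Nonempty),
    (∀ w ∈ C, ∀ i, 0 ≤ w i) ∧ ∀ x, f x = C.sup' hC (fun w => ∑ i, w i * bit (x i))

/-- The `ℓ₂`-norm with respect to the uniform distribution on `{0,1}^n`. -/
def l2Norm {n : ℕ} (f : (Fin n → Bool) → ℝ) : ℝ :=
  Real.sqrt (𝔼 x, f x ^ 2)

/-- The parity function `χ_S(x) = (-1)^{∑_{i ∈ S} x_i}`. -/
def parity {n : ℕ} (S : Finset (Fin n)) (x : Fin n → Bool) : ℝ :=
  (-1) ^ (∑ i ∈ S, (x i).toNat)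

/-- The Fourier coefficient `E_x[f(x) χ_S(x)]`, for `x` uniform on `{0,1}^n`. -/
def fourierHat {n : ℕ} (f : (Fin n → Bool) → ℝ) (S : Finset (Fin n)) : ℝ :=
  𝔼 x, f x * parity S x

open Classical in
/-- The Fourier degree: the largest `|S|` with nonzero coefficient at `S`
(`0` for the zero function). -/
def fourierDegree {n : ℕ} (f : (Fin n → Bool) → ℝ) : ℕ :=
  (Finset.univ.filter (fun S : Finset (Fin n) => fourierHat f S ≠ 0)).sup Finset.card

/-- The spectral `ℓ₁`-norm. -/
def spectralNorm1 {n : ℕ} (f : (Fin n → Bool) → ℝ) : ℝ :=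
  ∑ S : Finset (Fin n), |fourierHat f S|

/-- The function `f` is a `k`-junta: it depends on at most `k` of the coordinates. -/
def IsJunta {n : ℕ} (k : ℕ) (f : (Fin n → Bool) → ℝ) : Prop :=
  ∃ J : Finset (Fin n), J.card ≤ k ∧ DependsOn f (J : Set (Fin n))

end BoolCube

end

/-!
Upper bound. If `f` is XOS with values in `[0, 1]`, the terms at `z` of an optimal linear form are
weights `W z i ≥ 0` of total at most `1` with `f z - f y ≤ ∑ W z i` over the bits `i` in which `y`
and `z` differ. Hence the `ℓ₁`-influences of `f` add up to at most `1`, and expanding the square of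
the Laplacian two flips at a time gives `∑ |S|² f̂(S)² ≤ 5 / 4`: all but `ε² / 2` of the Fourier
weight has degree `O(1 / ε)`. Below that degree, Friedgut's hypercontractive argument, applied to
each derivative of `f`, shows that the weight on sets not contained in the `2 ^ O(1 / ε)` most
influential coordinates is at most `ε² / 2` as well.

Lower bound. Let `f` be the maximum, over `2 ^ b` disjoint blocks of `b + 1` bits, of the fraction
of ones in the block. Whether some block is full has probability bounded away from `0` and `1` and
changes `f` by at least `1 / (b + 1)`; a function that misses at least half of the blocks cannot
predict it.
-/

namespace BoolCube

open Finset

section Flip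

variable {ι : Type*} [DecidableEq ι]

/-- The point `x` with its `i`-th bit negated: the neighbour of `x` in direction `i`. -/
def flip (i : ι) (x : ι → Bool) : ι → Bool := Function.update x i (!x i)

lemma flip_self (i : ι) (x : ι → Bool) : flip i x i = !x i := by simp [flip]

lemma flip_of_ne {i j : ι} (h : j ≠ i) (x : ι → Bool) : flip i x j = x j := by simp [flip, h]

lemma flip_flip (i : ι) (x : ι → Bool) : flip i (flip i x) = x := by simp [flip]

lemma flip_comm (i j : ι) (x : ι → Bool) : flip i (flip j x) = flip j (flip i x) := by
  rcases eq_or_ne i j with rfl | h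
  · rfl
  · simp only [flip, Function.update_of_ne h, Function.update_of_ne h.symm]
    exact Function.update_comm h.symm _ _ _

/-- The amount by which `f` decreases when bit `i` of `x` is flipped, and `0` if it increases. -/
noncomputable def drop (f : (ι → Bool) → ℝ) (i : ι) (x : ι → Bool) : ℝ :=
  (f x - f (flip i x))⁺

lemma drop_nonneg (f : (ι → Bool) → ℝ) (i : ι) (x : ι → Bool) : 0 ≤ drop f i x :=
  posPart_nonneg _

/-- The `i`-th Laplacian of `f`: the part of the Fourier expansion of `f` that involves bit `i`. -/
noncomputable def lap (i : ι) (f : (ι → Bool) → ℝ) (x : ι → Bool) : ℝ :=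
  (f x - f (flip i x)) / 2

lemma drop_flip (f : (ι → Bool) → ℝ) (i : ι) (x : ι → Bool) :
    drop f i (flip i x) = (f x - f (flip i x))⁻ := by
  rw [drop, flip_flip, ← posPart_neg, neg_sub]

lemma lap_eq_drop_sub (f : (ι → Bool) → ℝ) (i : ι) (x : ι → Bool) :
    lap i f x = (drop f i x - drop f i (flip i x)) / 2 := by
  rw [drop_flip, drop, posPart_sub_negPart, lap]

lemma abs_lap_eq_drop_add (f : (ι → Bool) → ℝ) (i : ι) (x : ι → Bool) :
    |lap i f x| = (drop f i x + drop f i (flip i x)) / 2 := by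
  rw [drop_flip, drop, posPart_add_negPart, lap, abs_div, abs_two]

lemma abs_lap_le_one {f : (ι → Bool) → ℝ} (hf : ∀ x, |f x| ≤ 1) (i : ι) (x : ι → Bool) :
    |lap i f x| ≤ 1 := by
  rw [lap, abs_div, abs_two]
  linarith [abs_sub (f x) (f (flip i x)), hf x, hf (flip i x)]

variable [Fintype ι]

lemma expect_flip (i : ι) (φ : (ι → Bool) → ℝ) : 𝔼 x, φ (flip i x) = 𝔼 x, φ x :=
  Fintype.expect_equiv (Function.Involutive.toPerm (flip i) (flip_flip i)) _ _ fun _ => rfl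

lemma expect_eq_zero_of_flip_eq_neg (i : ι) {φ : (ι → Bool) → ℝ}
    (h : ∀ x, φ (flip i x) = -φ x) : 𝔼 x, φ x = 0 := by
  have h_neg : -𝔼 x, φ x = 𝔼 x, φ x := by
    rw [← expect_neg_distrib, ← expect_flip i φ]
    exact expect_congr rfl fun x _ => (h x).symm
  linarith

end Flip

section Certificate

variable {ι : Type*} [Fintype ι]

/-- The weights `W` certify that `f` decreases slowly: passing from `z` to `y` costs at most
`W z i` for every changed bit `i`, and the weights at each point add up to at most `1`. This is
the one-sided condition of Talagrand's convex distance inequality, with the `ℓ₁`-norm of the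
weights in place of the `ℓ₂`-norm; a maximum of affine functions whose linear parts have
`ℓ₁`-norm at most `1` satisfies it. -/
structure IsCertificate (W : (ι → Bool) → ι → ℝ) (f : (ι → Bool) → ℝ) : Prop where
  nonneg : ∀ z i, 0 ≤ W z i
  sum_le_one : ∀ z, ∑ i, W z i ≤ 1
  sub_le : ∀ z y, f z - f y ≤ ∑ i with y i ≠ z i, W z i

lemma bit_mem_Icc (c : Bool) : bit c ∈ Set.Icc (0 : ℝ) 1 := by cases c <;> simp [bit]

/-- The terms at `z` of a linear form attaining the maximum at `z` are the weights. -/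
lemma IsXOS.exists_isCertificate {n : ℕ} {f : (Fin n → Bool) → ℝ} (hf : IsXOS f)
    (hf_le : ∀ x, f x ≤ 1) : ∃ W, IsCertificate W f := by
  obtain ⟨C, hC, hC_nonneg, hfC⟩ := hf
  have exists_maximizer (z) : ∃ w ∈ C, f z = ∑ i, w i * bit (z i) := by
    rw [hfC]
    exact exists_mem_eq_sup' hC _
  choose w hwC hw using exists_maximizer
  have hw_nonneg (z i) (c : Bool) : 0 ≤ w z i * bit c :=
    mul_nonneg (hC_nonneg _ (hwC z) i) (bit_mem_Icc c).1
  refine ⟨fun z i => w z i * bit (z i), fun z i => hw_nonneg z i _,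
    fun z => (hw z).symm.trans_le (hf_le z), fun z y => ?_⟩
  have hy : ∑ i, w z i * bit (y i) ≤ f y := by
    rw [hfC y]
    exact le_sup' (fun w => ∑ i, w i * bit (y i)) (hwC z)
  calc f z - f y ≤ ∑ i, (w z i * bit (z i) - w z i * bit (y i)) := by
        rw [sum_sub_distrib, ← hw]
        linarith
    _ ≤ ∑ i, if y i ≠ z i then w z i * bit (z i) else 0 := by
        gcongr with i
        split_ifs with h
        · exact sub_le_self _ (hw_nonneg z i _)
        · rw [not_ne_iff.1 h, sub_self]
    _ = ∑ i with y i ≠ z i, w z i * bit (z i) := (sum_filter _ _).symm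

namespace IsCertificate

variable {W : (ι → Bool) → ι → ℝ} {f : (ι → Bool) → ℝ}

lemma sub_le_sum (h : IsCertificate W f) {z y : ι → Bool} {T : Finset ι}
    (hT : ∀ i ∉ T, y i = z i) : f z - f y ≤ ∑ i ∈ T, W z i :=
  (h.sub_le z y).trans <| sum_le_sum_of_subset_of_nonneg
    (fun i hi => not_imp_comm.1 (hT i) (mem_filter.1 hi).2) fun i _ _ => h.nonneg z i

lemma sum_sum_mul_le_one (h : IsCertificate W f) (y : ι → ι → Bool) (z : ι → Bool) :
    ∑ i, ∑ j, W z i * W (y i) j ≤ 1 := by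
  refine (sum_le_sum fun i _ => ?_).trans (h.sum_le_one z)
  rw [← mul_sum]
  exact mul_le_of_le_one_right (h.nonneg z i) (h.sum_le_one _)

variable [DecidableEq ι]

lemma drop_le (h : IsCertificate W f) (i : ι) (z : ι → Bool) : drop f i z ≤ W z i := by
  rw [drop, posPart_def]
  refine sup_le ?_ (h.nonneg z i)
  simpa using h.sub_le_sum (T := {i}) fun j hj => flip_of_ne (by simpa using hj) z

lemma sum_drop_le_one (h : IsCertificate W f) (z : ι → Bool) : ∑ i, drop f i z ≤ 1 :=
  (sum_le_sum fun i _ => h.drop_le i z).trans (h.sum_le_one z)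

lemma sub_flip_flip_le (h : IsCertificate W f) (i j : ι) (z : ι → Bool) :
    f z - f (flip i (flip j z)) ≤ W z i + W z j := by
  rcases eq_or_ne i j with rfl | hij
  · rw [flip_flip, sub_self]
    exact add_nonneg (h.nonneg z i) (h.nonneg z i)
  · refine (h.sub_le_sum fun k hk => ?_).trans_eq (sum_pair hij)
    simp only [mem_insert, mem_singleton, not_or] at hk
    rw [flip_of_ne hk.1, flip_of_ne hk.2]

lemma drop_flip_le (h : IsCertificate W f) (i j : ι) (z : ι → Bool) :
    drop f i (flip j z) ≤ W z i + W z j + W (flip j z) j := by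
  rw [drop, posPart_def]
  refine sup_le ?_ (by linarith [h.nonneg z i, h.nonneg z j, h.nonneg (flip j z) j])
  have h_back : f (flip j z) - f z ≤ W (flip j z) j := by
    simpa only [drop, flip_flip] using (le_posPart _).trans (h.drop_le j (flip j z))
  linarith [h.sub_flip_flip_le i j z]

lemma drop_mul_drop_le (h : IsCertificate W f) (i j : ι) (z : ι → Bool) :
    drop f i (flip j z) * drop f j (flip i z) ≤
      W z i * W (flip i z) j + W z j * W (flip j z) i +
        (W (flip i z) i * W (flip i z) j + W (flip j z) j * W (flip j z) i) := by
  wlog h_le : drop f j (flip i z) ≤ drop f i (flip j z) generalizing i j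
  · linarith [this j i (le_of_not_ge h_le)]
  -- Each weight times the smaller drop is bounded by the certificate for whichever drop
  -- leaves a product of weights with two different indices.
  set q := drop f j (flip i z)
  have hqi : q ≤ W (flip i z) j := h.drop_le j _
  have hqj : q ≤ W (flip j z) i := h_le.trans (h.drop_le i _)
  calc drop f i (flip j z) * q ≤ (W z i + W z j + W (flip j z) j) * q :=
        mul_le_mul_of_nonneg_right (h.drop_flip_le i j z) (drop_nonneg f j _)
    _ = W z i * q + W z j * q + W (flip j z) j * q := by ring
    _ ≤ W z i * W (flip i z) j + W z j * W (flip j z) i + W (flip j z) j * W (flip j z) i :=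
        add_le_add (add_le_add (mul_le_mul_of_nonneg_left hqi (h.nonneg z i))
          (mul_le_mul_of_nonneg_left hqj (h.nonneg z j)))
          (mul_le_mul_of_nonneg_left hqj (h.nonneg _ j))
    _ ≤ _ := by linarith [mul_nonneg (h.nonneg (flip i z) i) (h.nonneg (flip i z) j)]

lemma expect_drop_flip_mul_drop_flip_le (h : IsCertificate W f) (i j : ι) :
    𝔼 x, drop f i (flip i x) * drop f j (flip j x) ≤
      𝔼 z, (W z i * W (flip i z) j + W z j * W (flip j z) i + 2 * (W z i * W z j)) := by
  calc 𝔼 x, drop f i (flip i x) * drop f j (flip j x)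
      = 𝔼 z, drop f i (flip j z) * drop f j (flip i z) := by
        rw [← expect_flip i, ← expect_flip j]
        refine expect_congr rfl fun z _ => ?_
        rw [flip_flip, flip_comm i j, flip_flip]
    _ ≤ 𝔼 z, (W z i * W (flip i z) j + W z j * W (flip j z) i +
          (W (flip i z) i * W (flip i z) j + W (flip j z) j * W (flip j z) i)) :=
        expect_le_expect fun z _ => h.drop_mul_drop_le i j z
    _ = _ := by
        simp only [expect_add_distrib, expect_flip i fun z => W z i * W z j,
          expect_flip j fun z => W z j * W z i, ← mul_expect]
        simp only [mul_comm (W _ j) (W _ i)]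
        ring

lemma expect_sq_sum_drop_flip_le (h : IsCertificate W f) :
    𝔼 x, (∑ i, drop f i (flip i x)) ^ 2 ≤ 4 := by
  calc 𝔼 x, (∑ i, drop f i (flip i x)) ^ 2
      = ∑ i, ∑ j, 𝔼 x, drop f i (flip i x) * drop f j (flip j x) := by
        simp only [sq, sum_mul_sum, expect_sum_comm]
    _ ≤ ∑ i, ∑ j,
          𝔼 z, (W z i * W (flip i z) j + W z j * W (flip j z) i + 2 * (W z i * W z j)) :=
        sum_le_sum fun i _ => sum_le_sum fun j _ => h.expect_drop_flip_mul_drop_flip_le i j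
    _ = 𝔼 z, ∑ i, ∑ j,
          (W z i * W (flip i z) j + W z j * W (flip j z) i + 2 * (W z i * W z j)) := by
        simp only [expect_sum_comm]
    _ ≤ 4 := expect_le univ_nonempty fun z _ => by
        have h_flip : ∑ i, ∑ j, W z i * W (flip i z) j ≤ 1 := h.sum_sum_mul_le_one _ z
        have h_flip' : ∑ i, ∑ j, W z j * W (flip j z) i ≤ 1 := by rwa [sum_comm]
        have h_same : ∑ i, ∑ j, W z i * W z j ≤ 1 := h.sum_sum_mul_le_one (fun _ => z) z
        simp only [sum_add_distrib, ← mul_sum] at h_flip h_flip' h_same ⊢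
        linarith

end IsCertificate

variable [DecidableEq ι]

/-- The `ℓ₁`-influence of bit `i` on `f`. -/
noncomputable def influence (i : ι) (f : (ι → Bool) → ℝ) : ℝ := 𝔼 x, |lap i f x|

lemma influence_nonneg (i : ι) (f : (ι → Bool) → ℝ) : 0 ≤ influence i f :=
  expect_nonneg fun _ _ => abs_nonneg _

lemma influence_eq_expect_drop (i : ι) (f : (ι → Bool) → ℝ) :
    influence i f = 𝔼 x, drop f i x := by
  simp only [influence, abs_lap_eq_drop_add]
  rw [← expect_div, expect_add_distrib, expect_flip i (drop f i), add_self_div_two]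

namespace IsCertificate

variable {W : (ι → Bool) → ι → ℝ} {f : (ι → Bool) → ℝ}

lemma sum_influence_le_one (h : IsCertificate W f) : ∑ i, influence i f ≤ 1 := by
  simp only [influence_eq_expect_drop]
  rw [← expect_sum_comm]
  exact expect_le univ_nonempty fun x _ => h.sum_drop_le_one x

lemma expect_sq_sum_lap_le (h : IsCertificate W f) : 𝔼 x, (∑ i, lap i f x) ^ 2 ≤ 5 / 4 := by
  have pointwise (x) : (∑ i, lap i f x) ^ 2 ≤ (1 + (∑ i, drop f i (flip i x)) ^ 2) / 4 := by
    have h_down : 0 ≤ ∑ i, drop f i x := sum_nonneg fun i _ => drop_nonneg f i x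
    have h_up : 0 ≤ ∑ i, drop f i (flip i x) := sum_nonneg fun i _ => drop_nonneg f i _
    simp only [lap_eq_drop_sub, ← sum_div, sum_sub_distrib]
    nlinarith [mul_nonneg h_down h_up, h.sum_drop_le_one x]
  calc 𝔼 x, (∑ i, lap i f x) ^ 2 ≤ 𝔼 x, (1 + (∑ i, drop f i (flip i x)) ^ 2) / 4 :=
        expect_le_expect fun x _ => pointwise x
    _ = (1 + 𝔼 x, (∑ i, drop f i (flip i x)) ^ 2) / 4 := by
        rw [← expect_div, expect_add_distrib, Fintype.expect_const]
    _ ≤ 5 / 4 := by linarith [h.expect_sq_sum_drop_flip_le]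

end IsCertificate

end Certificate

section Fourier

variable {n : ℕ}

/-- The sign `(-1)^b` of a bit. -/
noncomputable def sgn (b : Bool) : ℝ := (-1) ^ b.toNat

lemma sgn_not (b : Bool) : sgn (!b) = -sgn b := by cases b <;> simp [sgn]

lemma sgn_mul_self (b : Bool) : sgn b * sgn b = 1 := by cases b <;> simp [sgn]

lemma parity_eq_prod (S : Finset (Fin n)) (x : Fin n → Bool) :
    parity S x = ∏ i ∈ S, sgn (x i) :=
  (prod_pow_eq_pow_sum S _ _).symm

lemma parity_mul_self (S : Finset (Fin n)) (x : Fin n → Bool) :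
    parity S x * parity S x = 1 := by
  rw [parity_eq_prod, ← prod_mul_distrib]
  exact prod_eq_one fun i _ => sgn_mul_self _

lemma abs_parity (S : Finset (Fin n)) (x : Fin n → Bool) : |parity S x| = 1 := by
  simp [parity]

lemma parity_flip_of_notMem {i : Fin n} {S : Finset (Fin n)} (h : i ∉ S) (x : Fin n → Bool) :
    parity S (flip i x) = parity S x := by
  rw [parity_eq_prod, parity_eq_prod]
  exact prod_congr rfl fun j hj => by rw [flip_of_ne (ne_of_mem_of_not_mem hj h)]

lemma parity_insert {i : Fin n} {S : Finset (Fin n)} (h : i ∉ S) (x : Fin n → Bool) :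
    parity (insert i S) x = sgn (x i) * parity S x := by
  rw [parity_eq_prod, parity_eq_prod, prod_insert h]

lemma parity_flip_of_mem {i : Fin n} {S : Finset (Fin n)} (h : i ∈ S) (x : Fin n → Bool) :
    parity S (flip i x) = -parity S x := by
  rw [← insert_erase h, parity_insert (notMem_erase i S), parity_insert (notMem_erase i S),
    parity_flip_of_notMem (notMem_erase i S), flip_self, sgn_not, neg_mul]

lemma expect_parity_mul_parity (S T : Finset (Fin n)) :
    𝔼 x, parity S x * parity T x = if S = T then 1 else 0 := by
  split_ifs with h
  · simp only [h, parity_mul_self, Fintype.expect_const]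
  · obtain ⟨i, hi⟩ : ∃ i, ¬(i ∈ S ↔ i ∈ T) := by
      by_contra! hc
      exact h (Finset.ext hc)
    refine expect_eq_zero_of_flip_eq_neg i fun x => ?_
    by_cases hS : i ∈ S
    · have hT : i ∉ T := by tauto
      rw [parity_flip_of_mem hS, parity_flip_of_notMem hT, neg_mul]
    · have hT : i ∈ T := by tauto
      rw [parity_flip_of_notMem hS, parity_flip_of_mem hT, mul_neg]

lemma sum_parity_mul_parity (x y : Fin n → Bool) :
    ∑ S : Finset (Fin n), parity S x * parity S y = if x = y then 2 ^ n else 0 := by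
  have h_prod : ∑ S : Finset (Fin n), parity S x * parity S y =
      ∏ i : Fin n, (1 + sgn (x i) * sgn (y i)) := by
    rw [prod_one_add, powerset_univ]
    exact sum_congr rfl fun S _ => by rw [parity_eq_prod, parity_eq_prod, prod_mul_distrib]
  rw [h_prod]
  split_ifs with hxy
  · simp only [hxy, sgn_mul_self, prod_const, card_fin]
    norm_num
  · obtain ⟨i, hi⟩ := Function.ne_iff.1 hxy
    refine prod_eq_zero (mem_univ i) ?_
    rw [Bool.eq_not.2 hi, sgn_not, neg_mul, sgn_mul_self, add_neg_cancel]

lemma sum_fourierHat_mul_parity (f : (Fin n → Bool) → ℝ) (x : Fin n → Bool) :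
    ∑ S, fourierHat f S * parity S x = f x := by
  calc ∑ S, fourierHat f S * parity S x
      = 𝔼 y, f y * ∑ S, parity S y * parity S x := by
        simp only [fourierHat, expect_mul, mul_sum, mul_assoc, expect_sum_comm]
    _ = f x := by
        rw [Fintype.expect_eq_sum_div_card]
        simp [sum_parity_mul_parity]

lemma expect_mul_eq_sum_fourierHat (f g : (Fin n → Bool) → ℝ) :
    𝔼 x, f x * g x = ∑ S, fourierHat f S * fourierHat g S := by
  calc 𝔼 x, f x * g x = 𝔼 x, ∑ S, fourierHat f S * (g x * parity S x) :=
        expect_congr rfl fun x _ => by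
          rw [← sum_fourierHat_mul_parity f x, sum_mul]
          exact sum_congr rfl fun S _ => by ring
    _ = ∑ S, fourierHat f S * fourierHat g S := by
        simp only [expect_sum_comm, ← mul_expect, fourierHat]

lemma expect_sq_eq_sum_fourierHat (f : (Fin n → Bool) → ℝ) :
    𝔼 x, f x ^ 2 = ∑ S, fourierHat f S ^ 2 := by
  simpa only [sq] using expect_mul_eq_sum_fourierHat f f

lemma fourierHat_sub (f g : (Fin n → Bool) → ℝ) (S : Finset (Fin n)) :
    fourierHat (f - g) S = fourierHat f S - fourierHat g S := by
  simp only [fourierHat, Pi.sub_apply, sub_mul, expect_sub_distrib]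

lemma fourierHat_sum {κ : Type*} (s : Finset κ) (f : κ → (Fin n → Bool) → ℝ)
    (S : Finset (Fin n)) :
    fourierHat (fun x => ∑ k ∈ s, f k x) S = ∑ k ∈ s, fourierHat (f k) S := by
  simp only [fourierHat, sum_mul, expect_sum_comm]

lemma abs_fourierHat_le_one {f : (Fin n → Bool) → ℝ} (hf : ∀ x, |f x| ≤ 1)
    (S : Finset (Fin n)) : |fourierHat f S| ≤ 1 := by
  refine (abs_expect_le _ _).trans (expect_le univ_nonempty fun x _ => ?_)
  rw [abs_mul, abs_parity, mul_one]
  exact hf x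

lemma fourierHat_lap (i : Fin n) (f : (Fin n → Bool) → ℝ) (S : Finset (Fin n)) :
    fourierHat (lap i f) S = if i ∈ S then fourierHat f S else 0 := by
  have h_flip : 𝔼 x, f (flip i x) * parity S (flip i x) = fourierHat f S :=
    expect_flip i fun x => f x * parity S x
  have h_lap : fourierHat (lap i f) S = (fourierHat f S - 𝔼 x, f (flip i x) * parity S x) / 2 := by
    simp only [fourierHat, lap, div_mul_eq_mul_div, sub_mul, ← expect_div, expect_sub_distrib]
  rw [h_lap, ← h_flip]
  split_ifs with hi
  · simp only [parity_flip_of_mem hi, mul_neg, expect_neg_distrib]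
    ring
  · simp only [parity_flip_of_notMem hi, sub_self, zero_div]

lemma sum_card_sq_mul_fourierHat_sq (f : (Fin n → Bool) → ℝ) :
    ∑ S, (S.card : ℝ) ^ 2 * fourierHat f S ^ 2 = 𝔼 x, (∑ i, lap i f x) ^ 2 := by
  rw [expect_sq_eq_sum_fourierHat]
  refine sum_congr rfl fun S _ => ?_
  rw [fourierHat_sum]
  simp [fourierHat_lap, mul_pow]

lemma sum_fourierHat_sq_card_gt_le (f : (Fin n → Bool) → ℝ) (d : ℕ) :
    ∑ S with d < S.card, fourierHat f S ^ 2 ≤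
      (∑ S, (S.card : ℝ) ^ 2 * fourierHat f S ^ 2) / ((d : ℝ) + 1) ^ 2 := by
  rw [le_div_iff₀' (by positivity), mul_sum]
  calc ∑ S with d < S.card, ((d : ℝ) + 1) ^ 2 * fourierHat f S ^ 2
      ≤ ∑ S with d < S.card, (S.card : ℝ) ^ 2 * fourierHat f S ^ 2 := by
        gcongr with S hS
        exact_mod_cast (mem_filter.1 hS).2
    _ ≤ ∑ S, (S.card : ℝ) ^ 2 * fourierHat f S ^ 2 :=
        sum_le_sum_of_subset_of_nonneg (subset_univ _) fun S _ _ => by positivity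

/-- The function whose Fourier coefficient at `S` is `a S` for `S ∈ 𝒜`, and `0` otherwise. -/
noncomputable def fourierSum (𝒜 : Finset (Finset (Fin n))) (a : Finset (Fin n) → ℝ)
    (x : Fin n → Bool) : ℝ :=
  ∑ S ∈ 𝒜, a S * parity S x

variable {𝒜 : Finset (Finset (Fin n))} {a : Finset (Fin n) → ℝ}

lemma fourierHat_fourierSum (T : Finset (Fin n)) :
    fourierHat (fourierSum 𝒜 a) T = if T ∈ 𝒜 then a T else 0 := by
  simp only [fourierHat, fourierSum, sum_mul, expect_sum_comm, mul_assoc, ← mul_expect,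
    expect_parity_mul_parity, mul_ite, mul_one, mul_zero, sum_ite_eq']

lemma expect_mul_fourierSum (g : (Fin n → Bool) → ℝ) :
    𝔼 x, g x * fourierSum 𝒜 a x = ∑ S ∈ 𝒜, fourierHat g S * a S := by
  simp only [fourierSum, mul_sum, expect_sum_comm, fourierHat, expect_mul]
  exact sum_congr rfl fun S _ => expect_congr rfl fun x _ => by ring

lemma expect_sq_sub_fourierSum (f : (Fin n → Bool) → ℝ) (𝒜 : Finset (Finset (Fin n))) :
    𝔼 x, (f - fourierSum 𝒜 (fourierHat f)) x ^ 2 = ∑ S ∈ 𝒜ᶜ, fourierHat f S ^ 2 := by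
  rw [expect_sq_eq_sum_fourierHat, compl_eq_univ_sdiff, ← filter_notMem_eq_sdiff, sum_filter]
  refine sum_congr rfl fun S _ => ?_
  rw [fourierHat_sub, fourierHat_fourierSum]
  split_ifs with h <;> simp_all

lemma fourierDegree_fourierSum_le {d : ℕ} (h : ∀ S ∈ 𝒜, S.card ≤ d) :
    fourierDegree (fourierSum 𝒜 a) ≤ d := by
  refine Finset.sup_le fun S hS => h S ?_
  by_contra hc
  simp [fourierHat_fourierSum, hc] at hS

lemma spectralNorm1_fourierSum (𝒜 : Finset (Finset (Fin n))) (a : Finset (Fin n) → ℝ) :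
    spectralNorm1 (fourierSum 𝒜 a) = ∑ S ∈ 𝒜, |a S| := by
  simp [spectralNorm1, fourierHat_fourierSum, apply_ite]

lemma dependsOn_fourierSum {J : Finset (Fin n)} (h : ∀ S ∈ 𝒜, S ⊆ J) :
    DependsOn (fourierSum 𝒜 a) (J : Set (Fin n)) := by
  intro x y hxy
  refine sum_congr rfl fun S hS => ?_
  rw [parity_eq_prod, parity_eq_prod]
  congr 1
  exact prod_congr rfl fun i hi => by rw [hxy i (h S hS hi)]

end Fourier

section Hypercontractivity

lemma expect_add_sgn_mul_pow_four {ι : Type*} [Fintype ι] [DecidableEq ι] {i : ι}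
    {g h : (ι → Bool) → ℝ} (hg : ∀ x, g (flip i x) = g x) (hh : ∀ x, h (flip i x) = h x) :
    𝔼 x, (g x + sgn (x i) * h x) ^ 4 =
      𝔼 x, g x ^ 4 + 6 * 𝔼 x, g x ^ 2 * h x ^ 2 + 𝔼 x, h x ^ 4 := by
  have odd_part : 𝔼 x, sgn (x i) * (4 * (g x ^ 3 * h x) + 4 * (g x * h x ^ 3)) = 0 :=
    expect_eq_zero_of_flip_eq_neg i fun x => by rw [flip_self, sgn_not, hg, hh, neg_mul]
  rw [mul_expect, ← expect_add_distrib, ← expect_add_distrib, ← add_zero (𝔼 x, (_ + _)),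
    ← odd_part, ← expect_add_distrib]
  refine expect_congr rfl fun x _ => ?_
  linear_combination (6 * g x ^ 2 * h x ^ 2 + 4 * sgn (x i) * g x * h x ^ 3
    + (sgn (x i) ^ 2 + 1) * h x ^ 4) * sgn_mul_self (x i)

lemma expect_add_sgn_mul_pow_four_le {ι : Type*} [Fintype ι] [DecidableEq ι] {i : ι}
    {g h : (ι → Bool) → ℝ} (hg : ∀ x, g (flip i x) = g x) (hh : ∀ x, h (flip i x) = h x)
    {A B : ℝ} (hA : 0 ≤ A) (hB : 0 ≤ B) (hgA : 𝔼 x, g x ^ 4 ≤ A ^ 2)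
    (hhB : 𝔼 x, h x ^ 4 ≤ B ^ 2) : 𝔼 x, (g x + sgn (x i) * h x) ^ 4 ≤ (A + 3 * B) ^ 2 := by
  have cauchy_schwarz : (𝔼 x, g x ^ 2 * h x ^ 2) ^ 2 ≤ (𝔼 x, g x ^ 4) * 𝔼 x, h x ^ 4 := by
    refine (expect_mul_sq_le_sq_mul_sq univ (fun x => g x ^ 2) fun x => h x ^ 2).trans_eq ?_
    simp only [← pow_mul]
  have mixed : 𝔼 x, g x ^ 2 * h x ^ 2 ≤ A * B := by
    refine le_of_sq_le_sq ?_ (mul_nonneg hA hB)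
    calc (𝔼 x, g x ^ 2 * h x ^ 2) ^ 2 ≤ (𝔼 x, g x ^ 4) * 𝔼 x, h x ^ 4 := cauchy_schwarz
      _ ≤ A ^ 2 * B ^ 2 := by gcongr
      _ = (A * B) ^ 2 := (mul_pow A B 2).symm
  calc 𝔼 x, (g x + sgn (x i) * h x) ^ 4
      = 𝔼 x, g x ^ 4 + 6 * 𝔼 x, g x ^ 2 * h x ^ 2 + 𝔼 x, h x ^ 4 :=
        expect_add_sgn_mul_pow_four hg hh
    _ ≤ A ^ 2 + 6 * (A * B) + B ^ 2 := by gcongr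
    _ ≤ (A + 3 * B) ^ 2 := by nlinarith [sq_nonneg B]

variable {n : ℕ}

lemma fourierSum_powerset_flip {T : Finset (Fin n)} {i : Fin n} (hi : i ∉ T)
    (a : Finset (Fin n) → ℝ) (x : Fin n → Bool) :
    fourierSum T.powerset a (flip i x) = fourierSum T.powerset a x :=
  sum_congr rfl fun S hS => by
    rw [parity_flip_of_notMem fun hiS => hi (mem_powerset.1 hS hiS)]

lemma fourierSum_powerset_insert {T : Finset (Fin n)} {i : Fin n} (hi : i ∉ T)
    (a : Finset (Fin n) → ℝ) (x : Fin n → Bool) :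
    fourierSum (insert i T).powerset a x =
      fourierSum T.powerset a x +
        sgn (x i) * fourierSum T.powerset (fun S => a (insert i S)) x := by
  rw [fourierSum, sum_powerset_insert hi, fourierSum, fourierSum, mul_sum]
  congr 1
  refine sum_congr rfl fun S hS => ?_
  rw [parity_insert fun hiS => hi (mem_powerset.1 hS hiS)]
  ring

lemma expect_fourierSum_powerset_pow_four_le (T : Finset (Fin n)) (a : Finset (Fin n) → ℝ) :
    𝔼 x, fourierSum T.powerset a x ^ 4 ≤ (∑ S ∈ T.powerset, 3 ^ S.card * a S ^ 2) ^ 2 := by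
  induction T using Finset.induction_on generalizing a with
  | empty => simp [fourierSum, parity, ← pow_mul]
  | insert i T hi ih =>
    have norm_insert : ∑ S ∈ (insert i T).powerset, 3 ^ S.card * a S ^ 2 =
        ∑ S ∈ T.powerset, 3 ^ S.card * a S ^ 2 +
          3 * ∑ S ∈ T.powerset, 3 ^ S.card * a (insert i S) ^ 2 := by
      rw [sum_powerset_insert hi, mul_sum]
      congr 1
      refine sum_congr rfl fun S hS => ?_
      rw [card_insert_of_notMem fun hiS => hi (mem_powerset.1 hS hiS)]
      ring
    simp only [norm_insert, fourierSum_powerset_insert hi]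
    exact expect_add_sgn_mul_pow_four_le (fourierSum_powerset_flip hi _)
      (fourierSum_powerset_flip hi _) (sum_nonneg fun S _ => by positivity)
      (sum_nonneg fun S _ => by positivity) (ih _) (ih _)

lemma expect_fourierSum_pow_four_le (𝒜 : Finset (Finset (Fin n))) (a : Finset (Fin n) → ℝ) :
    𝔼 x, fourierSum 𝒜 a x ^ 4 ≤ (∑ S ∈ 𝒜, 3 ^ S.card * a S ^ 2) ^ 2 := by
  simpa [fourierSum, ite_pow] using
    expect_fourierSum_powerset_pow_four_le univ fun S => if S ∈ 𝒜 then a S else 0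

lemma expect_mul_pow_four_le {α : Type*} [Fintype α] {g : α → ℝ} (hg : ∀ x, |g x| ≤ 1)
    (h : α → ℝ) : (𝔼 x, g x * h x) ^ 4 ≤ (𝔼 x, |g x|) ^ 3 * 𝔼 x, h x ^ 4 := by
  have split_sqrt : (𝔼 x, g x * h x) ^ 2 ≤ (𝔼 x, |g x|) * 𝔼 x, |g x| * h x ^ 2 := by
    calc (𝔼 x, g x * h x) ^ 2 ≤ (𝔼 x, |g x| * |h x|) ^ 2 := by
          refine sq_le_sq' ?_ (expect_le_expect fun x _ => (le_abs_self _).trans_eq (abs_mul _ _))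
          rw [← expect_neg_distrib]
          exact expect_le_expect fun x _ => by rw [← abs_mul]; exact neg_abs_le _
      _ = (𝔼 x, √|g x| * (√|g x| * |h x|)) ^ 2 := by
          simp only [← mul_assoc, Real.mul_self_sqrt (abs_nonneg _)]
      _ ≤ (𝔼 x, √|g x| ^ 2) * 𝔼 x, (√|g x| * |h x|) ^ 2 := expect_mul_sq_le_sq_mul_sq _ _ _
      _ = (𝔼 x, |g x|) * 𝔼 x, |g x| * h x ^ 2 := by
          simp only [mul_pow, Real.sq_sqrt (abs_nonneg _), sq_abs]
  have split_sq : (𝔼 x, |g x| * h x ^ 2) ^ 2 ≤ (𝔼 x, |g x|) * 𝔼 x, h x ^ 4 := by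
    calc (𝔼 x, |g x| * h x ^ 2) ^ 2 ≤ (𝔼 x, |g x| ^ 2) * 𝔼 x, (h x ^ 2) ^ 2 :=
          expect_mul_sq_le_sq_mul_sq _ _ _
      _ ≤ (𝔼 x, |g x|) * 𝔼 x, h x ^ 4 := by
          simp only [← pow_mul, Nat.reduceMul]
          gcongr with x
          exact pow_le_of_le_one (abs_nonneg _) (hg x) two_ne_zero
  calc (𝔼 x, g x * h x) ^ 4 = ((𝔼 x, g x * h x) ^ 2) ^ 2 := by ring
    _ ≤ ((𝔼 x, |g x|) * 𝔼 x, |g x| * h x ^ 2) ^ 2 := by gcongr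
    _ = (𝔼 x, |g x|) ^ 2 * (𝔼 x, |g x| * h x ^ 2) ^ 2 := mul_pow _ _ _
    _ ≤ (𝔼 x, |g x|) ^ 2 * ((𝔼 x, |g x|) * 𝔼 x, h x ^ 4) := by gcongr
    _ = (𝔼 x, |g x|) ^ 3 * 𝔼 x, h x ^ 4 := by ring

lemma sq_sum_fourierHat_sq_le {g : (Fin n → Bool) → ℝ} (hg : ∀ x, |g x| ≤ 1) {d : ℕ}
    {𝒜 : Finset (Finset (Fin n))} (h𝒜 : ∀ S ∈ 𝒜, S.card ≤ d) :
    (∑ S ∈ 𝒜, fourierHat g S ^ 2) ^ 2 ≤ (3 ^ d) ^ 2 * (𝔼 x, |g x|) ^ 3 := by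
  set weight := ∑ S ∈ 𝒜, fourierHat g S ^ 2
  have weight_nonneg : 0 ≤ weight := sum_nonneg fun S _ => sq_nonneg _
  have weight_eq : 𝔼 x, g x * fourierSum 𝒜 (fourierHat g) x = weight := by
    simp only [expect_mul_fourierSum, ← sq, weight]
  have l4_le : 𝔼 x, fourierSum 𝒜 (fourierHat g) x ^ 4 ≤ (3 ^ d * weight) ^ 2 := by
    refine (expect_fourierSum_pow_four_le _ _).trans ?_
    rw [mul_sum]
    gcongr with S hS
    · norm_num
    · exact h𝒜 S hS
  have bootstrap : weight ^ 2 * weight ^ 2 ≤ weight ^ 2 * ((3 ^ d) ^ 2 * (𝔼 x, |g x|) ^ 3) := by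
    calc weight ^ 2 * weight ^ 2 = weight ^ 4 := by ring
      _ ≤ (𝔼 x, |g x|) ^ 3 * 𝔼 x, fourierSum 𝒜 (fourierHat g) x ^ 4 := by
          rw [← weight_eq]
          exact expect_mul_pow_four_le hg _
      _ ≤ (𝔼 x, |g x|) ^ 3 * (3 ^ d * weight) ^ 2 := by gcongr
      _ = weight ^ 2 * ((3 ^ d) ^ 2 * (𝔼 x, |g x|) ^ 3) := by ring
  rcases weight_nonneg.eq_or_lt with h0 | h0
  · rw [← h0, zero_pow two_ne_zero]
    positivity
  · exact le_of_mul_le_mul_left bootstrap (by positivity)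

lemma sum_fourierHat_sq_le_mul_expect_abs {g : (Fin n → Bool) → ℝ} (hg : ∀ x, |g x| ≤ 1) {d : ℕ}
    {𝒜 : Finset (Finset (Fin n))} (h𝒜 : ∀ S ∈ 𝒜, S.card ≤ d) {ρ : ℝ} (hρ : 0 ≤ ρ)
    (h_small : 𝔼 x, |g x| ≤ ρ ^ 2) :
    ∑ S ∈ 𝒜, fourierHat g S ^ 2 ≤ 3 ^ d * ρ * 𝔼 x, |g x| := by
  refine le_of_sq_le_sq ?_ (by positivity)
  calc (∑ S ∈ 𝒜, fourierHat g S ^ 2) ^ 2 ≤ (3 ^ d) ^ 2 * (𝔼 x, |g x|) ^ 3 :=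
        sq_sum_fourierHat_sq_le hg h𝒜
    _ = (3 ^ d) ^ 2 * (𝔼 x, |g x|) * (𝔼 x, |g x|) ^ 2 := by ring
    _ ≤ (3 ^ d) ^ 2 * ρ ^ 2 * (𝔼 x, |g x|) ^ 2 := by gcongr
    _ = (3 ^ d * ρ * 𝔼 x, |g x|) ^ 2 := by ring

end Hypercontractivity

section JuntaApproximation

/-- The subsets of `J` with at most `d` elements. -/
def smallSubsets {α : Type*} (J : Finset α) (d : ℕ) : Finset (Finset α) :=
  {S ∈ J.powerset | S.card ≤ d}

lemma mem_smallSubsets {α : Type*} {J S : Finset α} {d : ℕ} :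
    S ∈ smallSubsets J d ↔ S ⊆ J ∧ S.card ≤ d := by simp [smallSubsets]

lemma card_smallSubsets_le {α : Type*} (J : Finset α) (d : ℕ) :
    (smallSubsets J d).card ≤ (J.card + 1) ^ d := by
  classical
  have h_sub : smallSubsets J d ⊆ (range (d + 1)).biUnion fun k => J.powersetCard k := by
    intro S hS
    obtain ⟨hSJ, hSd⟩ := mem_smallSubsets.1 hS
    exact mem_biUnion.2 ⟨S.card, mem_range_succ_iff.2 hSd, mem_powersetCard.2 ⟨hSJ, rfl⟩⟩
  calc (smallSubsets J d).card ≤ ∑ k ∈ range (d + 1), (J.powersetCard k).card :=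
        (card_le_card h_sub).trans card_biUnion_le
    _ ≤ ∑ k ∈ range (d + 1), J.card ^ k * 1 ^ (d - k) * d.choose k := by
        gcongr with k hk
        rw [card_powersetCard, one_pow, mul_one]
        exact (Nat.choose_le_pow _ _).trans <|
          Nat.le_mul_of_pos_right _ <| Nat.choose_pos <| mem_range_succ_iff.1 hk
    _ = (J.card + 1) ^ d := (add_pow _ _ _).symm

variable {n : ℕ} {f : (Fin n → Bool) → ℝ} {J : Finset (Fin n)} {d : ℕ}

lemma sum_fourierHat_sq_not_subset_le (hf : ∀ x, |f x| ≤ 1) {ρ : ℝ} (hρ : 0 ≤ ρ)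
    (hJ : ∀ i ∉ J, influence i f ≤ ρ ^ 2) :
    ∑ S with S.card ≤ d ∧ ¬S ⊆ J, fourierHat f S ^ 2 ≤ 3 ^ d * ρ * ∑ i, influence i f := by
  have le_sum_lap (S : Finset (Fin n)) (hS : ¬S ⊆ J) :
      fourierHat f S ^ 2 ≤ ∑ i ∈ Jᶜ, fourierHat (lap i f) S ^ 2 := by
    obtain ⟨i, hiS, hiJ⟩ := not_subset.1 hS
    have h_single := single_le_sum (f := fun i => fourierHat (lap i f) S ^ 2)
      (fun _ _ => sq_nonneg _) (mem_compl.2 hiJ)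
    rwa [fourierHat_lap, if_pos hiS] at h_single
  calc ∑ S with S.card ≤ d ∧ ¬S ⊆ J, fourierHat f S ^ 2
      ≤ ∑ S with S.card ≤ d ∧ ¬S ⊆ J, ∑ i ∈ Jᶜ, fourierHat (lap i f) S ^ 2 :=
        sum_le_sum fun S hS => le_sum_lap S (mem_filter.1 hS).2.2
    _ = ∑ i ∈ Jᶜ, ∑ S with S.card ≤ d ∧ ¬S ⊆ J, fourierHat (lap i f) S ^ 2 := sum_comm
    _ ≤ ∑ i ∈ Jᶜ, 3 ^ d * ρ * influence i f :=
        sum_le_sum fun i hi => sum_fourierHat_sq_le_mul_expect_abs (abs_lap_le_one hf i)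
          (fun S hS => (mem_filter.1 hS).2.1) hρ (hJ i (mem_compl.1 hi))
    _ ≤ ∑ i, 3 ^ d * ρ * influence i f :=
        sum_le_sum_of_subset_of_nonneg (subset_univ _) fun i _ _ =>
          mul_nonneg (by positivity) (influence_nonneg i f)
    _ = 3 ^ d * ρ * ∑ i, influence i f := (mul_sum _ _ _).symm

/-- The part of the Fourier expansion of `f` of degree at most `d` in the coordinates in `J`. -/
noncomputable def lowPart (J : Finset (Fin n)) (d : ℕ) (f : (Fin n → Bool) → ℝ) :
    (Fin n → Bool) → ℝ :=
  fourierSum (smallSubsets J d) (fourierHat f)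

variable (f J d)

lemma isJunta_lowPart : IsJunta J.card (lowPart J d f) :=
  ⟨J, le_rfl, dependsOn_fourierSum fun _ hS => (mem_smallSubsets.1 hS).1⟩

lemma fourierDegree_lowPart_le : fourierDegree (lowPart J d f) ≤ d :=
  fourierDegree_fourierSum_le fun _ hS => (mem_smallSubsets.1 hS).2

lemma expect_sq_sub_lowPart_le_expect_sq :
    𝔼 x, (f - lowPart J d f) x ^ 2 ≤ 𝔼 x, f x ^ 2 := by
  rw [lowPart, expect_sq_sub_fourierSum, expect_sq_eq_sum_fourierHat]
  exact sum_le_sum_of_subset_of_nonneg (subset_univ _) fun _ _ _ => sq_nonneg _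

variable {J d f}

lemma spectralNorm1_lowPart_le (hf : ∀ x, |f x| ≤ 1) :
    spectralNorm1 (lowPart J d f) ≤ ((J.card : ℝ) + 1) ^ d := by
  calc spectralNorm1 (lowPart J d f) = ∑ S ∈ smallSubsets J d, |fourierHat f S| :=
        spectralNorm1_fourierSum _ _
    _ ≤ (smallSubsets J d).card := by
        rw [← nsmul_one (smallSubsets J d).card]
        exact sum_le_card_nsmul _ _ _ fun S _ => abs_fourierHat_le_one hf S
    _ ≤ ((J.card : ℝ) + 1) ^ d := by exact_mod_cast card_smallSubsets_le J d

lemma expect_sq_sub_lowPart_le (hf : ∀ x, |f x| ≤ 1) {ρ : ℝ} (hρ : 0 ≤ ρ)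
    (hJ : ∀ i ∉ J, influence i f ≤ ρ ^ 2) :
    𝔼 x, (f - lowPart J d f) x ^ 2 ≤
      (∑ S, (S.card : ℝ) ^ 2 * fourierHat f S ^ 2) / ((d : ℝ) + 1) ^ 2 +
        3 ^ d * ρ * ∑ i, influence i f := by
  have h_compl : (smallSubsets J d)ᶜ =
      univ.filter (fun S => d < S.card) ∪ univ.filter fun S => S.card ≤ d ∧ ¬S ⊆ J := by
    ext S
    simp only [mem_compl, mem_smallSubsets, mem_union, mem_filter_univ]
    grind
  have h_disj : Disjoint (univ.filter fun S : Finset (Fin n) => d < S.card)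
      (univ.filter fun S => S.card ≤ d ∧ ¬S ⊆ J) :=
    disjoint_filter.2 fun S _ h_gt h_le => h_gt.not_ge h_le.1
  rw [lowPart, expect_sq_sub_fourierSum, h_compl, sum_union h_disj]
  exact add_le_add (sum_fourierHat_sq_card_gt_le f d) (sum_fourierHat_sq_not_subset_le hf hρ hJ)

open Classical in
/-- The coordinates whose `ℓ₁`-influence on `f` exceeds `τ`. -/
noncomputable def influential (f : (Fin n → Bool) → ℝ) (τ : ℝ) : Finset (Fin n) :=
  {i | τ < influence i f}

lemma influence_le_of_notMem_influential {τ : ℝ} {i : Fin n} (hi : i ∉ influential f τ) :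
    influence i f ≤ τ := by simpa [influential] using hi

lemma card_influential_mul_le (f : (Fin n → Bool) → ℝ) (τ : ℝ) :
    (influential f τ).card * τ ≤ ∑ i, influence i f := by
  rw [← nsmul_eq_mul]
  calc (influential f τ).card • τ ≤ ∑ i ∈ influential f τ, influence i f :=
        card_nsmul_le_sum _ _ _ fun i hi => (mem_filter.1 hi).2.le
    _ ≤ ∑ i, influence i f :=
        sum_le_sum_of_subset_of_nonneg (subset_univ _) fun i _ _ => influence_nonneg i f

lemma inv_le_two_rpow_inv {ε : ℝ} (hε : 0 < ε) (hε_le : ε ≤ 1) : 1 / ε ≤ (2 : ℝ) ^ (1 / ε) := by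
  have h_bernoulli := one_add_mul_self_le_rpow_one_add (s := 1) (by norm_num)
    ((one_le_div hε).2 hε_le)
  norm_num at h_bernoulli ⊢
  linarith

lemma two_le_two_rpow_inv {ε : ℝ} (hε : 0 < ε) (hε_le : ε ≤ 1) : 2 ≤ (2 : ℝ) ^ (1 / ε) :=
  Real.self_le_rpow_of_one_le one_le_two ((one_le_div hε).2 hε_le)

lemma inv_threshold_le {ε : ℝ} (hε : 0 < ε) (hε_le : ε ≤ 1) {d : ℕ} (hd : (d : ℝ) ≤ 3 / ε) :
    (ε ^ 2 / (2 * 3 ^ d))⁻¹ ≤ (2 : ℝ) ^ (9 / ε) := by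
  have h_pow : (3 : ℝ) ^ d ≤ 2 ^ (6 / ε) := by
    calc (3 : ℝ) ^ d ≤ 4 ^ d := by gcongr; norm_num
      _ = (2 : ℝ) ^ (2 * (d : ℝ)) := by
          rw [Real.rpow_mul zero_le_two, Real.rpow_natCast]
          norm_num
      _ ≤ 2 ^ (6 / ε) := by
          gcongr
          · exact one_le_two
          · linarith [show 6 / ε = 2 * (3 / ε) by ring]
  calc (ε ^ 2 / (2 * 3 ^ d))⁻¹ = 2 * 3 ^ d * (1 / ε) ^ 2 := by field_simp
    _ ≤ 2 ^ (1 / ε) * 2 ^ (6 / ε) * (2 ^ (1 / ε)) ^ 2 := by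
        gcongr
        · exact two_le_two_rpow_inv hε hε_le
        · exact inv_le_two_rpow_inv hε hε_le
    _ = 2 ^ (9 / ε) := by
        rw [← Real.rpow_mul_natCast zero_le_two, ← Real.rpow_add two_pos, ← Real.rpow_add two_pos]
        congr 1
        push_cast
        ring

lemma add_one_le_of_mul_threshold_sq_le {ε : ℝ} (hε : 0 < ε) (hε_le : ε ≤ 1) {d : ℕ}
    (hd : (d : ℝ) ≤ 3 / ε) {m : ℝ} (hm : m * (ε ^ 2 / (2 * 3 ^ d)) ^ 2 ≤ 1) :
    m + 1 ≤ (2 : ℝ) ^ (19 / ε) := by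
  have hm_le : m ≤ 2 ^ (18 / ε) := by
    calc m ≤ ((ε ^ 2 / (2 * 3 ^ d))⁻¹) ^ 2 := by
          rw [inv_pow, ← one_div, le_div_iff₀ (by positivity)]
          exact hm
      _ ≤ ((2 : ℝ) ^ (9 / ε)) ^ 2 := by gcongr; exact inv_threshold_le hε hε_le hd
      _ = 2 ^ (18 / ε) := by
          rw [← Real.rpow_mul_natCast zero_le_two]
          congr 1
          push_cast
          ring
  have one_le : (1 : ℝ) ≤ 2 ^ (18 / ε) := Real.one_le_rpow one_le_two (by positivity)
  calc m + 1 ≤ 2 * 2 ^ (18 / ε) := by linarith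
    _ ≤ 2 ^ (1 / ε) * 2 ^ (18 / ε) := by gcongr; exact two_le_two_rpow_inv hε hε_le
    _ = 2 ^ (19 / ε) := by rw [← Real.rpow_add two_pos]; congr 1; ring

namespace IsCertificate

variable {W : (Fin n → Bool) → Fin n → ℝ}

lemma expect_sq_sub_lowPart_influential_le (h : IsCertificate W f) (hf : ∀ x, |f x| ≤ 1) (d : ℕ)
    {ρ : ℝ} (hρ : 0 ≤ ρ) :
    𝔼 x, (f - lowPart (influential f (ρ ^ 2)) d f) x ^ 2 ≤
      5 / 4 / ((d : ℝ) + 1) ^ 2 + 3 ^ d * ρ := by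
  refine (expect_sq_sub_lowPart_le hf hρ fun i => influence_le_of_notMem_influential).trans ?_
  rw [sum_card_sq_mul_fourierHat_sq]
  refine add_le_add ?_ (mul_le_of_le_one_right (by positivity) h.sum_influence_le_one)
  gcongr
  exact h.expect_sq_sum_lap_le

lemma exists_lowPart_approx (h : IsCertificate W f) (hf : ∀ x, |f x| ≤ 1) {ε : ℝ} (hε : 0 < ε) :
    ∃ (J : Finset (Fin n)) (d : ℕ), (J.card : ℝ) + 1 ≤ 2 ^ (19 / ε) ∧ (d : ℝ) ≤ 3 / ε ∧
      𝔼 x, (f - lowPart J d f) x ^ 2 ≤ ε ^ 2 := by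
  rcases le_or_gt 1 ε with hε_ge | hε_lt
  · refine ⟨∅, 0, ?_, ?_, (expect_sq_sub_lowPart_le_expect_sq f ∅ 0).trans ?_⟩
    · simpa using Real.one_le_rpow one_le_two (by positivity : (0 : ℝ) ≤ 19 / ε)
    · rw [Nat.cast_zero]
      positivity
    · exact (expect_le univ_nonempty fun x _ => (sq_le_one_iff_abs_le_one _).2 (hf x)).trans
        (one_le_pow₀ hε_ge)
  set d := ⌈2 / ε⌉₊
  have le_d : 2 / ε ≤ d := Nat.le_ceil _
  have d_le : (d : ℝ) ≤ 3 / ε := by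
    have h_ceil : (d : ℝ) < 2 / ε + 1 := Nat.ceil_lt_add_one (by positivity)
    linarith [(one_le_div hε).2 hε_lt.le, show 3 / ε = 2 / ε + 1 / ε by ring]
  set ρ := ε ^ 2 / (2 * 3 ^ d)
  refine ⟨influential f (ρ ^ 2), d, ?_, d_le,
    (h.expect_sq_sub_lowPart_influential_le hf d (by positivity)).trans ?_⟩
  · exact add_one_le_of_mul_threshold_sq_le hε hε_lt.le d_le
      ((card_influential_mul_le f _).trans h.sum_influence_le_one)
  · have low : 3 ^ d * ρ = ε ^ 2 / 2 := by
      simp only [ρ]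
      field_simp
    have high : 5 / 4 / ((d : ℝ) + 1) ^ 2 ≤ 5 / 16 * ε ^ 2 := by
      rw [div_le_iff₀ hε] at le_d
      rw [div_le_iff₀ (by positivity), mul_assoc, ← mul_pow]
      nlinarith
    linarith [sq_nonneg ε]

theorem exists_junta_approx (h : IsCertificate W f) (hf : ∀ x, |f x| ≤ 1) {ε : ℝ} (hε : 0 < ε) :
    ∃ (k : ℕ) (p : (Fin n → Bool) → ℝ), (k : ℝ) ≤ (2 : ℝ) ^ (57 / ε) ∧ IsJunta k p ∧
      (fourierDegree p : ℝ) ≤ 57 / ε ∧ l2Norm (f - p) ≤ ε ∧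
      spectralNorm1 p ≤ (2 : ℝ) ^ (57 / ε ^ 2) := by
  obtain ⟨J, d, hJ, hd, h_approx⟩ := h.exists_lowPart_approx hf hε
  refine ⟨J.card, lowPart J d f, ?_, isJunta_lowPart f J d, ?_,
    Real.sqrt_le_iff.2 ⟨hε.le, h_approx⟩, ?_⟩
  · calc (J.card : ℝ) ≤ 2 ^ (19 / ε) := by linarith
      _ ≤ 2 ^ (57 / ε) := by gcongr <;> norm_num
  · calc (fourierDegree (lowPart J d f) : ℝ) ≤ d := by
          exact_mod_cast fourierDegree_lowPart_le f J d
      _ ≤ 3 / ε := hd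
      _ ≤ 57 / ε := by gcongr; norm_num
  · calc spectralNorm1 (lowPart J d f) ≤ ((J.card : ℝ) + 1) ^ d := spectralNorm1_lowPart_le hf
      _ ≤ ((2 : ℝ) ^ (19 / ε)) ^ d := by gcongr
      _ = 2 ^ (19 / ε * d) := (Real.rpow_mul_natCast zero_le_two _ _).symm
      _ ≤ 2 ^ (19 / ε * (3 / ε)) := by gcongr; exact one_le_two
      _ = 2 ^ (57 / ε ^ 2) := by congr 1; field_simp; norm_num

end IsCertificate

end JuntaApproximation

section UniformMeasure

lemma dens_mul_le_expect {α : Type*} [Fintype α] {A : Finset α} {φ : α → ℝ}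
    {c : ℝ} (hφ : ∀ x, 0 ≤ φ x) (hA : ∀ x ∈ A, c ≤ φ x) : A.dens * c ≤ 𝔼 x, φ x := by
  classical
  calc A.dens * c = 𝔼 x, if x ∈ A then c else 0 := by
        simp [Fintype.expect_eq_sum_div_card, sum_ite_mem, nnratCast_dens, div_mul_eq_mul_div]
    _ ≤ 𝔼 x, φ x := expect_le_expect fun x _ => by
        split_ifs with hx
        exacts [hA x hx, hφ x]

lemma mul_half_sub_sq_le_expect_sub_sq {α : Type*} [Fintype α] {A B : Finset α}
    {φ : α → ℝ} {u v c : ℝ} (huv : u ≤ v) (hA : c ≤ A.dens) (hB : c ≤ B.dens)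
    (hφA : ∀ x ∈ A, φ x ≤ u) (hφB : ∀ x ∈ B, v ≤ φ x) (s : ℝ) :
    c * ((v - u) / 2) ^ 2 ≤ 𝔼 x, (φ x - s) ^ 2 := by
  have le_of_dens {D : Finset α} (hD : c ≤ D.dens)
      (h_far : ∀ x ∈ D, ((v - u) / 2) ^ 2 ≤ (φ x - s) ^ 2) :
      c * ((v - u) / 2) ^ 2 ≤ 𝔼 x, (φ x - s) ^ 2 :=
    (mul_le_mul_of_nonneg_right hD (sq_nonneg _)).trans
      (dens_mul_le_expect (fun x => sq_nonneg _) h_far)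
  rcases le_total ((u + v) / 2) s with hs | hs
  · refine le_of_dens hA fun x hx => ?_
    rw [sub_sq_comm (φ x)]
    exact pow_le_pow_left₀ (by linarith) (by linarith [hφA x hx]) 2
  · exact le_of_dens hB fun x hx => pow_le_pow_left₀ (by linarith) (by linarith [hφB x hx]) 2

lemma dens_forall_mem_ne {ι α : Type*} [Fintype ι] [DecidableEq ι] [Fintype α] [DecidableEq α]
    (U : Finset ι) (a : α) :
    (({z | ∀ j ∈ U, z j ≠ a} : Finset (ι → α)).dens : ℝ) =
      (1 - 1 / Fintype.card α) ^ U.card := by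
  have h_card : (Fintype.card α : ℝ) ≠ 0 := by
    exact_mod_cast (Fintype.card_pos_iff.2 ⟨a⟩).ne'
  have h_pi : ({z | ∀ j ∈ U, z j ≠ a} : Finset (ι → α)) =
      Fintype.piFinset fun j => if j ∈ U then {a}ᶜ else univ := by
    ext z
    simp only [mem_filter_univ, Fintype.mem_piFinset]
    refine forall_congr' fun j => ?_
    split_ifs with hj <;> simp [hj]
  have h_factor (j : ι) : ((if j ∈ U then {a}ᶜ else univ : Finset α).card : ℝ) / Fintype.card α =
      if j ∈ U then 1 - 1 / (Fintype.card α : ℝ) else 1 := by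
    split_ifs
    · rw [card_compl, card_singleton, Nat.cast_pred (Fintype.card_pos_iff.2 ⟨a⟩), sub_div,
        div_self h_card]
    · rw [card_univ, div_self h_card]
  rw [nnratCast_dens, h_pi, Fintype.card_piFinset, Fintype.card_pi, Nat.cast_prod, Nat.cast_prod,
    ← prod_div_distrib]
  simp only [h_factor, prod_ite_mem, univ_inter, prod_const]

variable {ι α : Type*} [Fintype ι] [DecidableEq ι] [Fintype α] [Nonempty α]

lemma expect_piecewise (T : Finset ι) (φ : (ι → α) → ℝ) :
    𝔼 x, 𝔼 y, φ (T.piecewise x y) = 𝔼 x, φ x := by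
  let exchange (q : (ι → α) × (ι → α)) := (T.piecewise q.1 q.2, T.piecewise q.2 q.1)
  have h_exchange : Function.Involutive exchange := fun q => by
    ext k <;> by_cases hk : k ∈ T <;> simp [exchange, hk]
  calc 𝔼 x, 𝔼 y, φ (T.piecewise x y)
      = 𝔼 q : (ι → α) × (ι → α), φ (T.piecewise q.1 q.2) := by
        rw [← univ_product_univ, expect_product]
    _ = 𝔼 q : (ι → α) × (ι → α), φ q.1 :=
        Fintype.expect_equiv h_exchange.toPerm _ _ fun _ => rfl
    _ = 𝔼 x, φ x := by
        rw [← univ_product_univ, expect_product]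
        simp only [Fintype.expect_const]

lemma expect_sub_sq_eq_expect_expect_of_dependsOn {T : Finset ι} {g : (ι → α) → ℝ}
    (hg : DependsOn g (T : Set ι)) (φ : (ι → α) → ℝ) :
    𝔼 x, (φ x - g x) ^ 2 = 𝔼 x, 𝔼 y, (φ (T.piecewise x y) - g x) ^ 2 := by
  rw [← expect_piecewise T]
  refine expect_congr rfl fun x _ => expect_congr rfl fun y _ => ?_
  rw [hg fun k hk => piecewise_eq_of_mem T x y hk]

end UniformMeasure

section JuntaLowerBound

lemma expect_bit_mem_Icc {ι : Type*} [Fintype ι] [Nonempty ι] (z : ι → Bool) :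
    𝔼 i, bit (z i) ∈ Set.Icc (0 : ℝ) 1 :=
  ⟨expect_nonneg fun _ _ => (bit_mem_Icc _).1,
    expect_le univ_nonempty fun _ _ => (bit_mem_Icc _).2⟩

lemma expect_bit_le_of_ne_top {ι : Type*} [Fintype ι] {z : ι → Bool} (hz : z ≠ ⊤) :
    𝔼 i, bit (z i) ≤ 1 - 1 / Fintype.card ι := by
  obtain ⟨i₀, hi₀⟩ := Function.ne_iff.1 hz
  have : Nonempty ι := ⟨i₀⟩
  have h_zero : bit (z i₀) = 0 := by simpa [bit] using hi₀
  have h_missing : (({i₀} : Finset ι).dens : ℝ) * 1 ≤ 𝔼 i, (1 - bit (z i)) :=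
    dens_mul_le_expect (fun i => sub_nonneg.2 (bit_mem_Icc _).2) fun i hi => by
      rw [mem_singleton.1 hi, h_zero, sub_zero]
  rw [expect_sub_distrib, Fintype.expect_const, nnratCast_dens, card_singleton, Nat.cast_one,
    mul_one] at h_missing
  linarith

variable {m b : ℕ}

/-- A point of `{0,1}^{mb}` as a family of `m` consecutive blocks of `b` bits; `Fin.divNat` is the
index of the block that contains a coordinate. -/
def blocks : (Fin (m * b) → Bool) ≃ (Fin m → Fin b → Bool) :=
  (finProdFinEquiv.arrowCongr (Equiv.refl Bool)).symm.trans (Equiv.curry _ _ _)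

lemma blocks_apply (x : Fin (m * b) → Bool) (j : Fin m) (i : Fin b) :
    blocks x j i = x (finProdFinEquiv (j, i)) := rfl

lemma divNat_finProdFinEquiv (j : Fin m) (i : Fin b) : (finProdFinEquiv (j, i)).divNat = j :=
  congrArg Prod.fst (finProdFinEquiv.symm_apply_apply (j, i))

/-- The weights of the linear form that averages the `j`-th block. -/
noncomputable def blockWeight (m b : ℕ) (j : Fin m) (k : Fin (m * b)) : ℝ :=
  if k.divNat = j then 1 / b else 0

lemma sum_blockWeight_mul_bit (j : Fin m) (x : Fin (m * b) → Bool) :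
    ∑ k, blockWeight m b j k * bit (x k) = 𝔼 i, bit (blocks x j i) := by
  rw [← finProdFinEquiv.sum_comp, Fintype.sum_prod_type]
  simp only [blockWeight, divNat_finProdFinEquiv, ite_mul, zero_mul]
  rw [sum_eq_single j (fun j' _ hj' => by simp [hj']) (by simp), Fintype.expect_eq_sum_div_card,
    sum_div]
  simp [blocks_apply, div_eq_inv_mul]

/-- The largest fraction of ones in one of the `m` blocks of `b` bits. -/
noncomputable def maxBlockMean (m b : ℕ) [NeZero m] (x : Fin (m * b) → Bool) : ℝ :=
  univ.sup' univ_nonempty fun j => 𝔼 i, bit (blocks x j i)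

lemma isXOS_maxBlockMean [NeZero m] : IsXOS (maxBlockMean m b) := by
  refine ⟨univ.image (blockWeight m b), univ_nonempty.image _, fun w hw k => ?_, fun x => ?_⟩
  · obtain ⟨j, -, rfl⟩ := mem_image.1 hw
    unfold blockWeight
    split_ifs <;> positivity
  · simp only [sup'_image, Function.comp_def, sum_blockWeight_mul_bit, maxBlockMean]

lemma expect_bit_le_maxBlockMean [NeZero m] (x : Fin (m * b) → Bool) (j : Fin m) :
    𝔼 i, bit (blocks x j i) ≤ maxBlockMean m b x :=
  le_sup' (fun j => 𝔼 i, bit (blocks x j i)) (mem_univ j)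

lemma maxBlockMean_le [NeZero m] {x : Fin (m * b) → Bool} {a : ℝ}
    (h : ∀ j, 𝔼 i, bit (blocks x j i) ≤ a) : maxBlockMean m b x ≤ a :=
  sup'_le _ _ fun j _ => h j

lemma maxBlockMean_mem_Icc [NeZero m] [NeZero b] (x : Fin (m * b) → Bool) :
    maxBlockMean m b x ∈ Set.Icc (0 : ℝ) 1 :=
  ⟨(expect_bit_mem_Icc _).1.trans (expect_bit_le_maxBlockMean x 0),
    maxBlockMean_le fun _ => (expect_bit_mem_Icc _).2⟩

lemma one_le_maxBlockMean [NeZero m] [NeZero b] {x : Fin (m * b) → Bool} {j : Fin m}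
    (h : blocks x j = ⊤) : 1 ≤ maxBlockMean m b x := by
  refine le_trans (Eq.ge ?_) (expect_bit_le_maxBlockMean x j)
  simp [h, bit]

lemma maxBlockMean_le_of_forall_ne_top [NeZero m] {x : Fin (m * b) → Bool}
    (h : ∀ j, blocks x j ≠ ⊤) : maxBlockMean m b x ≤ 1 - 1 / b :=
  maxBlockMean_le fun j => by simpa using expect_bit_le_of_ne_top (h j)

/-- The event that no block with index in `U` consists of ones only. -/
def noFullBlock (b : ℕ) (U : Finset (Fin m)) : Finset (Fin (m * b) → Bool) :=
  {x | ∀ j ∈ U, blocks x j ≠ ⊤}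

lemma mem_noFullBlock {U : Finset (Fin m)} {x : Fin (m * b) → Bool} :
    x ∈ noFullBlock b U ↔ ∀ j ∈ U, blocks x j ≠ ⊤ := by simp [noFullBlock]

lemma dens_noFullBlock (U : Finset (Fin m)) :
    ((noFullBlock b U).dens : ℝ) = (1 - 1 / 2 ^ b) ^ U.card := by
  have h_map : (noFullBlock b U).map blocks.toEmbedding =
      ({z | ∀ j ∈ U, z j ≠ ⊤} : Finset (Fin m → Fin b → Bool)) := by
    ext z
    simp [noFullBlock, mem_map_equiv]
  rw [← dens_map_equiv blocks, h_map]
  simpa using dens_forall_mem_ne U (⊤ : Fin b → Bool)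

lemma half_le_dens_noFullBlock {U : Finset (Fin m)} (hU : 2 * U.card ≤ 2 ^ b) :
    1 / 2 ≤ ((noFullBlock b U).dens : ℝ) := by
  have two_card_le : 2 * (U.card : ℝ) ≤ 2 ^ b := by exact_mod_cast hU
  have inv_le_one : 1 / (2 : ℝ) ^ b ≤ 1 := by
    rw [div_le_one (by positivity)]
    exact one_le_pow₀ one_le_two
  have bernoulli := one_add_mul_le_pow (a := -(1 / (2 : ℝ) ^ b)) (by linarith) U.card
  have mul_inv_le : U.card * (1 / (2 : ℝ) ^ b) ≤ 1 / 2 := by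
    rw [mul_one_div, div_le_iff₀ (by positivity)]
    linarith
  rw [dens_noFullBlock, sub_eq_add_neg]
  linarith

lemma dens_noFullBlock_le {U : Finset (Fin m)} (hU : 2 ^ b ≤ 4 * U.card) :
    ((noFullBlock b U).dens : ℝ) ≤ 4 / 5 := by
  set a : ℝ := 1 / 2 ^ b
  have a_nonneg : 0 ≤ a := by positivity
  have a_le_one : a ≤ 1 := by
    rw [div_le_one (by positivity)]
    exact one_le_pow₀ one_le_two
  have quarter_le : 1 / 4 ≤ U.card * a := by
    have le_four_card : (2 : ℝ) ^ b ≤ 4 * U.card := by exact_mod_cast hU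
    rw [mul_one_div, le_div_iff₀ (by positivity)]
    linarith
  have bernoulli := one_add_mul_le_pow (a := a) (by linarith) U.card
  have product_le_one : (1 - a) ^ U.card * (1 + a) ^ U.card ≤ 1 := by
    rw [← mul_pow]
    exact pow_le_one₀ (mul_nonneg (by linarith) (by linarith)) (by nlinarith)
  have one_sub_pow_nonneg : 0 ≤ (1 - a) ^ U.card := pow_nonneg (by linarith) _
  rw [dens_noFullBlock]
  nlinarith

/-- The coordinates in the blocks with index in `A`. -/
def blockCoords (b : ℕ) (A : Finset (Fin m)) : Finset (Fin (m * b)) := {k | k.divNat ∈ A}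

lemma subset_blockCoords_image (J : Finset (Fin (m * b))) :
    J ⊆ blockCoords b (J.image Fin.divNat) := fun _ hk => by
  simpa [blockCoords] using ⟨_, hk, rfl⟩

lemma blocks_piecewise (A : Finset (Fin m)) (x y : Fin (m * b) → Bool) :
    blocks ((blockCoords b A).piecewise x y) = A.piecewise (blocks x) (blocks y) := by
  funext j i
  by_cases hj : j ∈ A <;>
    simp [blocks_apply, piecewise, blockCoords, divNat_finProdFinEquiv, hj]

/-- With the blocks in `A` fixed, the presence of a full block outside `A` remains undecided and
changes the value by at least `1 / b`. -/
lemma le_expect_sq_maxBlockMean_piecewise_sub [NeZero m] [NeZero b] {A : Finset (Fin m)}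
    (h_compl_le : 2 * Aᶜ.card ≤ 2 ^ b) (h_le_compl : 2 ^ b ≤ 4 * Aᶜ.card) {x : Fin (m * b) → Bool}
    (hx : x ∈ noFullBlock b A) (s : ℝ) :
    1 / 5 * (1 / b / 2) ^ 2 ≤
      𝔼 y, (maxBlockMean m b ((blockCoords b A).piecewise x y) - s) ^ 2 := by
  have dens_compl : ((noFullBlock b Aᶜ)ᶜ.dens : ℝ) = 1 - (noFullBlock b Aᶜ).dens := by
    rw [eq_sub_iff_add_eq]
    rw [compl_eq_univ_sdiff]
    exact_mod_cast (dens_sdiff_add_dens_eq_dens (subset_univ _)).trans dens_univ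
  have key := mul_half_sub_sq_le_expect_sub_sq (c := 1 / 5) (u := 1 - 1 / (b : ℝ)) (v := 1)
    (A := noFullBlock b Aᶜ) (B := (noFullBlock b Aᶜ)ᶜ)
    (φ := fun y => maxBlockMean m b ((blockCoords b A).piecewise x y))
    (sub_le_self _ (by positivity)) (by linarith [half_le_dens_noFullBlock h_compl_le])
    (by linarith [dens_noFullBlock_le h_le_compl]) ?_ ?_ s
  · rwa [sub_sub_cancel] at key
  · intro y hy
    refine maxBlockMean_le_of_forall_ne_top fun j => ?_
    rw [blocks_piecewise]
    by_cases hj : j ∈ A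
    · rw [piecewise_eq_of_mem _ _ _ hj]
      exact mem_noFullBlock.1 hx j hj
    · rw [piecewise_eq_of_notMem _ _ _ hj]
      exact mem_noFullBlock.1 hy j (mem_compl.2 hj)
  · intro y hy
    simp only [mem_compl, mem_noFullBlock, not_forall, not_not] at hy
    obtain ⟨j, hj, hj_full⟩ := hy
    refine one_le_maxBlockMean (j := j) ?_
    rw [blocks_piecewise, piecewise_eq_of_notMem _ _ _ hj, hj_full]

lemma le_expect_sq_maxBlockMean_sub [NeZero m] [NeZero b] {g : (Fin (m * b) → Bool) → ℝ}
    {A : Finset (Fin m)} (hg : DependsOn g (blockCoords b A : Set (Fin (m * b))))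
    (hA : 2 * A.card ≤ 2 ^ b) (h_compl_le : 2 * Aᶜ.card ≤ 2 ^ b)
    (h_le_compl : 2 ^ b ≤ 4 * Aᶜ.card) :
    1 / (40 * (b : ℝ) ^ 2) ≤ 𝔼 x, (maxBlockMean m b - g) x ^ 2 := by
  calc 1 / (40 * (b : ℝ) ^ 2) = 1 / 2 * (1 / 5 * (1 / b / 2) ^ 2) := by ring
    _ ≤ ((noFullBlock b A).dens : ℝ) * (1 / 5 * (1 / b / 2) ^ 2) := by
        gcongr
        exact half_le_dens_noFullBlock hA
    _ ≤ 𝔼 x, 𝔼 y, (maxBlockMean m b ((blockCoords b A).piecewise x y) - g x) ^ 2 :=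
        dens_mul_le_expect (fun x => expect_nonneg fun y _ => sq_nonneg _) fun x hx =>
          le_expect_sq_maxBlockMean_piecewise_sub h_compl_le h_le_compl hx (g x)
    _ = 𝔼 x, (maxBlockMean m b - g) x ^ 2 :=
        (expect_sub_sq_eq_expect_expect_of_dependsOn hg _).symm

/-- With `2 ^ b` blocks of `b + 1` bits, the expected number of full blocks is `1 / 2`. -/
lemma le_l2Norm_maxBlockMean_sub {k : ℕ} {g : (Fin (2 ^ b * (b + 1)) → Bool) → ℝ}
    (hg : IsJunta k g) (hk : 2 * k < 2 ^ b) :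
    1 / (7 * ((b : ℝ) + 1)) < l2Norm (maxBlockMean (2 ^ b) (b + 1) - g) := by
  obtain ⟨J, hJk, hgJ⟩ := hg
  set A := J.image Fin.divNat
  have card_A_le : A.card ≤ k := card_image_le.trans hJk
  have card_add : A.card + Aᶜ.card = 2 ^ b := by rw [card_add_card_compl, Fintype.card_fin]
  have hgA : DependsOn g (blockCoords (b + 1) A : Set (Fin (2 ^ b * (b + 1)))) :=
    fun x y hxy => hgJ fun i hi => hxy i (subset_blockCoords_image J hi)
  have h_error := le_expect_sq_maxBlockMean_sub hgA (by lia) (by lia) (by lia)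
  refine Real.lt_sqrt_of_sq_lt (lt_of_lt_of_le ?_ h_error)
  rw [div_pow, one_pow, mul_pow, Nat.cast_add_one]
  gcongr
  norm_num

theorem exists_isXOS_forall_junta_le {ε : ℝ} (hε : 0 < ε) (hε_le : ε ≤ 1 / 56) :
    ∃ (n : ℕ) (f : (Fin n → Bool) → ℝ), IsXOS f ∧ (∀ x, f x ∈ Set.Icc (0 : ℝ) 1) ∧
      ∀ (k : ℕ) (g : (Fin n → Bool) → ℝ), IsJunta k g → l2Norm (f - g) ≤ ε →
        (2 : ℝ) ^ (1 / 14 / ε) ≤ (k : ℝ) := by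
  have eight_le : 8 ≤ 1 / (7 * ε) := by
    rw [le_div_iff₀ (by positivity)]
    linarith
  obtain ⟨b, hb⟩ : ∃ b : ℕ, ⌊1 / (7 * ε)⌋₊ = b + 1 :=
    Nat.exists_eq_add_one.2 (Nat.floor_pos.2 (by linarith))
  obtain ⟨b_le, lt_b⟩ := (Nat.floor_eq_iff (by positivity)).1 hb
  push_cast at b_le lt_b
  refine ⟨2 ^ b * (b + 1), maxBlockMean (2 ^ b) (b + 1), isXOS_maxBlockMean, maxBlockMean_mem_Icc,
    fun k g hg h_approx => ?_⟩
  have two_pow_le : (2 : ℝ) ^ b ≤ 2 * k := by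
    by_contra! hk
    refine (le_l2Norm_maxBlockMean_sub hg (by exact_mod_cast hk)).not_ge (h_approx.trans ?_)
    rw [le_div_iff₀ (by positivity)] at b_le ⊢
    linarith
  have exponent_le : 1 / 14 / ε + 1 ≤ b := by
    linarith [show 1 / 14 / ε = 1 / (7 * ε) / 2 by field_simp; norm_num]
  have two_mul_le : (2 : ℝ) ^ (1 / 14 / ε) * 2 ≤ 2 * k := by
    calc (2 : ℝ) ^ (1 / 14 / ε) * 2 = 2 ^ (1 / 14 / ε + 1) := by
          rw [Real.rpow_add_one two_ne_zero]
      _ ≤ 2 ^ (b : ℝ) := Real.rpow_le_rpow_of_exponent_le one_le_two exponent_le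
      _ ≤ 2 * k := by rwa [Real.rpow_natCast]
  linarith

end JuntaLowerBound

end BoolCube

theorem mainTheorem8_general :
    (∃ K : ℝ, 0 < K ∧
      ∀ (n : ℕ) (f : (Fin n → Bool) → ℝ), (∃ W, BoolCube.IsCertificate W f) →
        (∀ x, |f x| ≤ 1) →
        ∀ ε : ℝ, 0 < ε →
          ∃ (k : ℕ) (p : (Fin n → Bool) → ℝ),
            (k : ℝ) ≤ (2 : ℝ) ^ (K / ε) ∧
            BoolCube.IsJunta k p ∧
            (BoolCube.fourierDegree p : ℝ) ≤ K / ε ∧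
            BoolCube.l2Norm (f - p) ≤ ε ∧
            BoolCube.spectralNorm1 p ≤ (2 : ℝ) ^ (K / ε ^ 2)) ∧
    (∃ c ε₀ : ℝ, 0 < c ∧ 0 < ε₀ ∧
      ∀ ε : ℝ, 0 < ε → ε ≤ ε₀ →
        ∃ (n : ℕ) (f : (Fin n → Bool) → ℝ), BoolCube.IsXOS f ∧
          (∀ x, f x ∈ Set.Icc (0 : ℝ) 1) ∧
          ∀ (k : ℕ) (g : (Fin n → Bool) → ℝ), BoolCube.IsJunta k g →
            BoolCube.l2Norm (f - g) ≤ ε → (2 : ℝ) ^ (c / ε) ≤ (k : ℝ)) :=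
  ⟨⟨57, by norm_num, fun _ _ ⟨_, hW⟩ hf _ hε => hW.exists_junta_approx hf hε⟩,
    1 / 14, 1 / 56, by norm_num, by norm_num,
    fun _ hε hε_le => BoolCube.exists_isXOS_forall_junta_le hε hε_le⟩

theorem mainTheorem8 :
    (∃ K : ℝ, 0 < K ∧
      ∀ (n : ℕ) (f : (Fin n → Bool) → ℝ), BoolCube.IsXOS f → (∀ x, f x ∈ Set.Icc (0 : ℝ) 1) →
        ∀ ε : ℝ, 0 < ε →
          ∃ (k : ℕ) (p : (Fin n → Bool) → ℝ),
            (k : ℝ) ≤ (2 : ℝ) ^ (K / ε) ∧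
            BoolCube.IsJunta k p ∧
            (BoolCube.fourierDegree p : ℝ) ≤ K / ε ∧
            BoolCube.l2Norm (f - p) ≤ ε ∧
            BoolCube.spectralNorm1 p ≤ (2 : ℝ) ^ (K / ε ^ 2)) ∧
    (∃ c ε₀ : ℝ, 0 < c ∧ 0 < ε₀ ∧
      ∀ ε : ℝ, 0 < ε → ε ≤ ε₀ →
        ∃ (n : ℕ) (f : (Fin n → Bool) → ℝ), BoolCube.IsXOS f ∧
          (∀ x, f x ∈ Set.Icc (0 : ℝ) 1) ∧
          ∀ (k : ℕ) (g : (Fin n → Bool) → ℝ), BoolCube.IsJunta k g →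
            BoolCube.l2Norm (f - g) ≤ ε → (2 : ℝ) ^ (c / ε) ≤ (k : ℝ)) :=
  mainTheorem8_general.imp_left fun ⟨K, hK, approx⟩ => ⟨K, hK, fun n f hf h01 =>
    approx n f (hf.exists_isCertificate fun x => (h01 x).2)
      fun x => (abs_of_nonneg (h01 x).1).trans_le (h01 x).2⟩
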